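/- An \emph{ultragraph} $\mathcal G=(G^0,\mathcal G^1,r,s)$ consists of a countable set $G^0$ of vertices, a countable set $\mathcal G^1$ of edges, a map $s:\mathcal G^1\to G^0$ and a map $r:\mathcal G^1\to\mathcal P(G^0)\setminus\{\emptyset\}$. Let $\mathcal G^0\subseteq\mathcal P(G^0)$ be the smallest family that contains $\emptyset$, all $\{v\}$ ($v\in G^0$) and all $r(e)$ ($e\in\mathcal G^1$) and is closed under finite unions, finite intersections and relative complements. A finite path is either an element $A\in\mathcal G^0$ (of length $0$) or a sequence of edges $\alpha=\alpha_1\cdots\alpha_k$, $k\ge 1$, with $s(\alpha_{i+1})\in r(\alpha_i)$ (of length $|\alpha|=k$); $\mathcal G^*$ is the set of finite paths. For a unital commutative ring $R$, the \emph{ultragraph Leavitt path algebra} $L_R(\mathcal G)$ is the universal (not necessarily unital) associative $R$-algebra generated by $\{s_e,s_e^*:e\in\mathcal G^1\}\cup\{p_A:A\in\mathcal G^0\}$ subject to (1) $p_\emptyset=0$, $p_Ap_B=p_{A\cap B}$, $p_{A\cup B}=p_A+p_B-p_{A\cap B}$ for $A,B\in\mathcal G^0$; (2) $p_{s(e)}s_e=s_ep_{r(e)}=s_e$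 and $p_{r(e)}s_e^*=s_e^*p_{s(e)}=s_e^*$ for $e\in\mathcal G^1$ (where $p_v=p_{\{v\}}$); (3) $s_e^*s_f=\delta_{e,f}\,p_{r(e)}$ for $e,f\in\mathcal G^1$; (4) $p_v=\sum_{s(e)=v}s_es_e^*$ whenever $0<|s^{-1}(v)|<\infty$. Put $s_\alpha=s_{\alpha_1}\cdots s_{\alpha_k}$ and $s_\alpha^*=s_{\alpha_k}^*\cdots s_{\alpha_1}^*$ for $\alpha=\alpha_1\cdots\alpha_k$, and $s_A=s_A^*=p_A$ for $A\in\mathcal G^0$. For $n\in\mathbb Z$ let $$L_R(\mathcal G)_n=\mathrm{span}_R\{s_\alpha p_As_\beta^*:\alpha,\beta\in\mathcal G^*,\ A\in\mathcal G^0,\ |\alpha|-|\beta|=n\}.$$ If $R$ carries an involution $*$, then $L_R(\mathcal G)$ carries the involution $\bigl(\sum_i r_is_{\alpha_i}p_{A_i}s_{\beta_i}^*\bigr)^*=\sum_i r_i^*s_{\beta_i}p_{A_i}s_{\alpha_i}^*$. \textbf{Proposition.} Let $R=\prod_{i=1}^nF_i$ be a finite product of fields (equivalently, a unital commutative semisimple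 ring). Let each $F_i$ have an involution (possibly trivial), and let $R$ have the involution $(r_1,\dots,r_n)^*=(r_1^*,\dots,r_n^*)$. Let $\mathcal G$ be an ultragraph. Equip $\prod_iL_{F_i}(\mathcal G)$ with the componentwise operations, scalar multiplication $(r_1,\dots,r_n)(x_1,\dots,x_n)=(r_1x_1,\dots,r_nx_n)$ and involution, and with the components $\bigl(\prod_iL_{F_i}(\mathcal G)\bigr)_k=\prod_iL_{F_i}(\mathcal G)_k$, $k\in\mathbb Z$. Then $L_R(\mathcal G)$ and $\prod_iL_{F_i}(\mathcal G)$, with these components, are $\mathbb Z$-graded $*$-rings (that is, $S=\bigoplus_kS_k$, $S_jS_k\subseteq S_{j+k}$ and $S_k^*\subseteq S_{-k}$), and they are $\mathbb Z$-graded $*$-isomorphic: there is an isomorphism of $R$-algebras $\phi:L_R(\mathcal G)\to\prod_iL_{F_i}(\mathcal G)$ with $\phi(x^*)=\phi(x)^*$ for all $x$ and $\phi(L_R(\mathcal G)_k)=\bigl(\prod_iL_{F_i}(\mathcal G)\bigr)_k$ for all $k\in\mathbb Z$. -/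

import Mathlib

open MulOpposite

/-- An ultragraph with vertex set `V` and edge set `E`, both countable: every edge has a source
vertex and a nonempty set of vertices as its range. -/
structure Ultragraph (V : Type*) (E : Type*) where
  countable_vertices : Countable V
  countable_edges : Countable E
  source : E → V
  range : E → Set V
  range_nonempty : ∀ e, (range e).Nonempty

namespace Ultragraph

/-- Membership in the smallest family of sets of vertices that contains the singletons, the ranges
of the edges and the empty set, and is closed under finite unions, finite intersections and
relative complements. -/
inductive IsGenVertex {V E : Type*} (G : Ultragraph V E) : Set V → Prop
  | singleton (v : V) : IsGenVertex G {v}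
  | range (e : E) : IsGenVertex G (G.range e)
  | empty : IsGenVertex G ∅
  | union {A B : Set V} : IsGenVertex G A → IsGenVertex G B → IsGenVertex G (A ∪ B)
  | inter {A B : Set V} : IsGenVertex G A → IsGenVertex G B → IsGenVertex G (A ∩ B)
  | sdiff {A B : Set V} : IsGenVertex G A → IsGenVertex G B → IsGenVertex G (A \ B)

/-- The generalized vertices of an ultragraph. -/
def GenVertex {V E : Type*} (G : Ultragraph V E) : Type _ := {A : Set V // G.IsGenVertex A}

namespace GenVertex

def empty {V E : Type*} (G : Ultragraph V E) : G.GenVertex := ⟨∅, .empty⟩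

def singleton {V E : Type*} (G : Ultragraph V E) (v : V) : G.GenVertex := ⟨{v}, .singleton v⟩

def range {V E : Type*} (G : Ultragraph V E) (e : E) : G.GenVertex := ⟨G.range e, .range e⟩

def union {V E : Type*} {G : Ultragraph V E} (A B : G.GenVertex) : G.GenVertex :=
  ⟨A.1 ∪ B.1, .union A.2 B.2⟩

def inter {V E : Type*} {G : Ultragraph V E} (A B : G.GenVertex) : G.GenVertex :=
  ⟨A.1 ∩ B.1, .inter A.2 B.2⟩

end GenVertex

/-- The finite paths: generalized vertices (length `0`), and nonempty sequences `e :: l` of edges in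
which the source of each edge lies in the range of the edge before it. -/
inductive FinPath {V E : Type*} (G : Ultragraph V E) : Type _
  | vertex (A : G.GenVertex) : FinPath G
  | edges (e : E) (l : List E)
      (chain : List.IsChain (fun e f => G.source f ∈ G.range e) (e :: l)) : FinPath G

def FinPath.length {V E : Type*} {G : Ultragraph V E} : G.FinPath → ℕ
  | .vertex _ => 0
  | .edges _ l _ => l.length + 1

/-- The symbols `s_e`, `s_e^*` (`e` an edge) and `p_A` (`A` a generalized vertex). -/
inductive Gen {V E : Type*} (G : Ultragraph V E) : Type _
  | edge (e : E) : Gen G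
  | ghost (e : E) : Gen G
  | proj (A : G.GenVertex) : Gen G

/-- The involution `s_e ↔ s_e^*`, `p_A ↔ p_A` of the symbols. -/
def Gen.swap {V E : Type*} {G : Ultragraph V E} : G.Gen → G.Gen
  | .edge e => .ghost e
  | .ghost e => .edge e
  | .proj A => .proj A

theorem Gen.swap_swap {V E : Type*} {G : Ultragraph V E} (g : G.Gen) : g.swap.swap = g := by
  cases g <;> rfl

end Ultragraph

section Leavitt

open Ultragraph

variable (R : Type*) [CommRing R] {V E : Type*} (G : Ultragraph V E)

/-- The free associative, not necessarily unital `R`-algebra on the symbols: the formal `R`-linear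
combinations of nonempty words. -/
abbrev FreeUltraAlg : Type _ := MonoidAlgebra R (FreeSemigroup G.Gen)

noncomputable section

variable {G} in
/-- A symbol as an element of the free algebra. -/
def FreeUltraAlg.of (g : G.Gen) : FreeUltraAlg R G := MonoidAlgebra.single (FreeSemigroup.of g) 1

/-- The defining relations of the ultragraph Leavitt path algebra and their scalar multiples. -/
inductive LeavittRel : FreeUltraAlg R G → FreeUltraAlg R G → Prop
  | proj_empty : LeavittRel (.of R (.proj (.empty G))) 0
  | proj_inter (A B : G.GenVertex) :
      LeavittRel (.of R (.proj A) * .of R (.proj B)) (.of R (.proj (A.inter B)))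
  | proj_union (A B : G.GenVertex) :
      LeavittRel (.of R (.proj (A.union B)))
        (.of R (.proj A) + .of R (.proj B) - .of R (.proj (A.inter B)))
  | source_edge (e : E) :
      LeavittRel (.of R (.proj (.singleton G (G.source e))) * .of R (.edge e)) (.of R (.edge e))
  | edge_range (e : E) :
      LeavittRel (.of R (.edge e) * .of R (.proj (.range G e))) (.of R (.edge e))
  | range_ghost (e : E) :
      LeavittRel (.of R (.proj (.range G e)) * .of R (.ghost e)) (.of R (.ghost e))
  | ghost_source (e : E) :
      LeavittRel (.of R (.ghost e) * .of R (.proj (.singleton G (G.source e)))) (.of R (.ghost e))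
  | ghost_edge_self (e : E) :
      LeavittRel (.of R (.ghost e) * .of R (.edge e)) (.of R (.proj (.range G e)))
  | ghost_edge_of_ne (e f : E) (hef : e ≠ f) :
      LeavittRel (.of R (.ghost e) * .of R (.edge f)) 0
  | regular (v : V) (hfin : {e | G.source e = v}.Finite) (hne : {e | G.source e = v}.Nonempty) :
      LeavittRel (.of R (.proj (.singleton G v)))
        (∑ e ∈ hfin.toFinset, .of R (.edge e) * .of R (.ghost e))
  | smul (r : R) {x y : FreeUltraAlg R G} : LeavittRel x y → LeavittRel (r • x) (r • y)

/-- The `R`-algebra congruence generated by the defining relations. -/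
def leavittCon : RingCon (FreeUltraAlg R G) := ringConGen (LeavittRel R G)

/-- The ultragraph Leavitt path algebra `L_R(G)`: the universal (not necessarily unital) associative
`R`-algebra on the symbols subject to the defining relations. -/
def UltraLPA : Type _ := (leavittCon R G).Quotient

theorem leavittCon_smul (r : R) {x y : FreeUltraAlg R G} (h : leavittCon R G x y) :
    leavittCon R G (r • x) (r • y) := by
  change RingConGen.Rel (LeavittRel R G) x y at h
  change RingConGen.Rel (LeavittRel R G) (r • x) (r • y)
  induction h with
  | of x y h => exact .of _ _ (.smul r h)
  | refl x => exact .refl _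
  | symm _ ih => exact .symm ih
  | trans _ _ ih₁ ih₂ => exact .trans ih₁ ih₂
  | add _ _ ih₁ ih₂ => rw [smul_add, smul_add]; exact .add ih₁ ih₂
  | mul _ h₂ ih₁ _ => rw [← smul_mul_assoc, ← smul_mul_assoc]; exact .mul ih₁ h₂

namespace UltraLPA

instance : NonUnitalRing (UltraLPA R G) := inferInstanceAs (NonUnitalRing (leavittCon R G).Quotient)

/-- The quotient map from the free algebra. -/
def mk : FreeUltraAlg R G →ₙ+* UltraLPA R G where
  toFun x := (x : (leavittCon R G).Quotient)
  map_mul' _ _ := rfl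
  map_zero' := rfl
  map_add' _ _ := rfl

theorem mk_surjective : Function.Surjective (mk R G) := fun x => Quotient.inductionOn' x
  fun a => ⟨a, rfl⟩

instance : SMul R (UltraLPA R G) where
  smul r := Quotient.map' (r • ·) fun _ _ h => leavittCon_smul R G r h

theorem smul_mk (r : R) (x : FreeUltraAlg R G) : r • mk R G x = mk R G (r • x) := rfl

instance : Module R (UltraLPA R G) :=
  Function.Surjective.module R (mk R G).toAddMonoidHom (mk_surjective R G) fun r x =>
    (smul_mk R G r x).symm

instance : IsScalarTower R (UltraLPA R G) (UltraLPA R G) where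
  smul_assoc r x y := by
    obtain ⟨x, rfl⟩ := mk_surjective R G x
    obtain ⟨y, rfl⟩ := mk_surjective R G y
    simp only [smul_eq_mul, smul_mk, ← map_mul, smul_mul_assoc]

instance : SMulCommClass R (UltraLPA R G) (UltraLPA R G) where
  smul_comm r x y := by
    obtain ⟨x, rfl⟩ := mk_surjective R G x
    obtain ⟨y, rfl⟩ := mk_surjective R G y
    simp only [smul_eq_mul, smul_mk, ← map_mul, mul_smul_comm]

variable {G}

/-- The generator `s_e`. -/
def edge (e : E) : UltraLPA R G := mk R G (.of R (.edge e))

/-- The generator `s_e^*`. -/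
def ghost (e : E) : UltraLPA R G := mk R G (.of R (.ghost e))

/-- The generator `p_A`. -/
def proj (A : G.GenVertex) : UltraLPA R G := mk R G (.of R (.proj A))

/-- `edgeProd R e₁ [e₂, …, eₙ] = s_{e₁} s_{e₂} ⋯ s_{eₙ}`. -/
def edgeProd (e : E) : List E → UltraLPA R G
  | [] => edge R e
  | f :: l => edge R e * edgeProd f l

/-- `ghostProd R e₁ [e₂, …, eₙ] = s_{eₙ}^* ⋯ s_{e₂}^* s_{e₁}^*`. -/
def ghostProd (e : E) : List E → UltraLPA R G
  | [] => ghost R e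
  | f :: l => ghostProd f l * ghost R e

/-- `s_α` for a finite path `α`, where `s_A = p_A` for a generalized vertex `A`. -/
def path : G.FinPath → UltraLPA R G
  | .vertex A => proj R A
  | .edges e l _ => edgeProd R e l

/-- `s_α^*` for a finite path `α`, where `s_A^* = p_A` for a generalized vertex `A`. -/
def ghostPath : G.FinPath → UltraLPA R G
  | .vertex A => proj R A
  | .edges e l _ => ghostProd R e l

variable (G)

/-- The homogeneous component `L_R(G)_n`, the `R`-span of the `s_α p_A s_β^*` with
`|α| - |β| = n`. -/
def homogeneous (n : ℤ) : Submodule R (UltraLPA R G) :=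
  Submodule.span R {x | ∃ (α β : G.FinPath) (A : G.GenVertex),
    (α.length : ℤ) - (β.length : ℤ) = n ∧ x = path R α * proj R A * ghostPath R β}

end UltraLPA

section Star

/-- Reversal of words combined with `s_e ↔ s_e^*`. -/
def wordStar (w : FreeSemigroup G.Gen) : FreeSemigroup G.Gen :=
  unop (FreeSemigroup.lift (fun g : G.Gen => op (FreeSemigroup.of g.swap)) w)

theorem wordStar_of (g : G.Gen) : wordStar G (.of g) = .of g.swap := by
  simp [wordStar]

theorem wordStar_mul (x y : FreeSemigroup G.Gen) :
    wordStar G (x * y) = wordStar G y * wordStar G x := by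
  simp [wordStar]

theorem wordStar_wordStar (x : FreeSemigroup G.Gen) : wordStar G (wordStar G x) = x := by
  induction x using FreeSemigroup.recOnMul with
  | ih1 g => rw [wordStar_of, wordStar_of, Gen.swap_swap]
  | ih2 g x ih₁ ih₂ => rw [wordStar_mul, wordStar_mul, ih₁, ih₂]

variable [StarRing R]

/-- The conjugate-linear anti-automorphism of the free algebra with `s_e ↔ s_e^*`, `p_A ↔ p_A`. -/
def freeStar : FreeUltraAlg R G →+ FreeUltraAlg R G where
  toFun x := MonoidAlgebra.mapDomain (wordStar G)
    (MonoidAlgebra.map (starAddEquiv (R := R)).toAddMonoidHom x)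
  map_zero' := by simp
  map_add' _ _ := by simp [MonoidAlgebra.map_add, MonoidAlgebra.mapDomain_add]

theorem freeStar_single (w : FreeSemigroup G.Gen) (r : R) :
    freeStar R G (.single w r) = .single (wordStar G w) (star r) := by
  simp [freeStar]

theorem freeStar_of (g : G.Gen) : freeStar R G (.of R g) = .of R g.swap := by
  simp [FreeUltraAlg.of, freeStar_single, wordStar_of]

theorem freeStar_mul (x y : FreeUltraAlg R G) :
    freeStar R G (x * y) = freeStar R G y * freeStar R G x := by
  induction x using MonoidAlgebra.induction_linear with
  | zero => simp
  | add a b ha hb => rw [add_mul, map_add, ha, hb, map_add, mul_add]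
  | single w r =>
    induction y using MonoidAlgebra.induction_linear with
    | zero => simp
    | add a b ha hb => rw [mul_add, map_add, ha, hb, map_add, add_mul]
    | single w' r' =>
      simp only [MonoidAlgebra.single_mul_single, freeStar_single, wordStar_mul, star_mul]

theorem freeStar_smul (r : R) (x : FreeUltraAlg R G) :
    freeStar R G (r • x) = star r • freeStar R G x := by
  induction x using MonoidAlgebra.induction_linear with
  | zero => simp
  | add a b ha hb => rw [smul_add, map_add, ha, hb, map_add, smul_add]
  | single w r' => simp [MonoidAlgebra.smul_single, freeStar_single]

theorem freeStar_freeStar (x : FreeUltraAlg R G) : freeStar R G (freeStar R G x) = x := by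
  induction x using MonoidAlgebra.induction_linear with
  | zero => simp
  | add a b ha hb => rw [map_add, map_add, ha, hb]
  | single w r => rw [freeStar_single, freeStar_single, wordStar_wordStar, star_star]

theorem leavittRel_freeStar {x y : FreeUltraAlg R G} (h : LeavittRel R G x y) :
    leavittCon R G (freeStar R G x) (freeStar R G y) := by
  induction h with
  | smul r _ ih => rw [freeStar_smul, freeStar_smul]; exact leavittCon_smul R G (star r) ih
  | proj_empty =>
    simp only [freeStar_of, Gen.swap, map_zero]
    exact .of _ _ .proj_empty
  | proj_inter A B =>
    have hAB : A.inter B = B.inter A := Subtype.ext (Set.inter_comm _ _)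
    simp only [freeStar_mul, freeStar_of, Gen.swap, hAB]
    exact .of _ _ (.proj_inter B A)
  | proj_union A B =>
    simp only [map_add, map_sub, freeStar_of, Gen.swap]
    exact .of _ _ (.proj_union A B)
  | source_edge e =>
    simp only [freeStar_mul, freeStar_of, Gen.swap]
    exact .of _ _ (.ghost_source e)
  | edge_range e =>
    simp only [freeStar_mul, freeStar_of, Gen.swap]
    exact .of _ _ (.range_ghost e)
  | range_ghost e =>
    simp only [freeStar_mul, freeStar_of, Gen.swap]
    exact .of _ _ (.edge_range e)
  | ghost_source e =>
    simp only [freeStar_mul, freeStar_of, Gen.swap]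
    exact .of _ _ (.source_edge e)
  | ghost_edge_self e =>
    simp only [freeStar_mul, freeStar_of, Gen.swap]
    exact .of _ _ (.ghost_edge_self e)
  | ghost_edge_of_ne e f hef =>
    simp only [freeStar_mul, freeStar_of, Gen.swap, map_zero]
    exact .of _ _ (.ghost_edge_of_ne f e hef.symm)
  | regular v hfin hne =>
    simp only [map_sum, freeStar_mul, freeStar_of, Gen.swap]
    exact .of _ _ (.regular v hfin hne)

theorem leavittCon_freeStar {x y : FreeUltraAlg R G} (h : leavittCon R G x y) :
    leavittCon R G (freeStar R G x) (freeStar R G y) := by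
  change RingConGen.Rel (LeavittRel R G) x y at h
  induction h with
  | of x y h => exact leavittRel_freeStar R G h
  | refl x => exact (leavittCon R G).refl _
  | symm _ ih => exact (leavittCon R G).symm ih
  | trans _ _ ih₁ ih₂ => exact (leavittCon R G).trans ih₁ ih₂
  | add _ _ ih₁ ih₂ => rw [(freeStar R G).map_add, (freeStar R G).map_add]; exact (leavittCon R G).add ih₁ ih₂
  | mul _ _ ih₁ ih₂ => rw [freeStar_mul, freeStar_mul]; exact (leavittCon R G).mul ih₂ ih₁

namespace UltraLPA

instance : Star (UltraLPA R G) where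
  star := Quotient.map' (freeStar R G) fun _ _ h => leavittCon_freeStar R G h

theorem star_mk (x : FreeUltraAlg R G) : star (mk R G x) = mk R G (freeStar R G x) := rfl

/-- The involution `(∑ rᵢ s_{αᵢ} p_{Aᵢ} s_{βᵢ}^*)^* = ∑ rᵢ^* s_{βᵢ} p_{Aᵢ} s_{αᵢ}^*` of `L_R(G)`. -/
instance : StarRing (UltraLPA R G) where
  star_involutive x := by
    obtain ⟨x, rfl⟩ := mk_surjective R G x
    rw [star_mk, star_mk, freeStar_freeStar]
  star_mul x y := by
    obtain ⟨x, rfl⟩ := mk_surjective R G x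
    obtain ⟨y, rfl⟩ := mk_surjective R G y
    rw [← map_mul, star_mk, freeStar_mul, map_mul, star_mk, star_mk]
  star_add x y := by
    obtain ⟨x, rfl⟩ := mk_surjective R G x
    obtain ⟨y, rfl⟩ := mk_surjective R G y
    rw [← map_add, star_mk, map_add, map_add, star_mk, star_mk]

variable {G}

theorem star_smul_monomial (r : R) (α β : G.FinPath) (A : G.GenVertex) :
    star (r • (path R α * proj R A * ghostPath R β)) =
      star r • (path R β * proj R A * ghostPath R α) := by
  have hsm : ∀ x : UltraLPA R G, star (r • x) = star r • star x := fun x => by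
    obtain ⟨x, rfl⟩ := mk_surjective R G x
    rw [smul_mk, star_mk, freeStar_smul, star_mk, smul_mk]
  have hp : ∀ B : G.GenVertex, star (proj R B) = proj R B := fun B => by
    rw [proj, star_mk, freeStar_of]; rfl
  have he : ∀ e : E, star (edge R e : UltraLPA R G) = ghost R e := fun e => by
    rw [edge, star_mk, freeStar_of]; rfl
  have hl : ∀ (l : List E) (e : E), star (edgeProd R e l : UltraLPA R G) = ghostProd R e l := by
    intro l
    induction l with
    | nil => exact he
    | cons f l ih => intro e; rw [edgeProd, star_mul, ih, he, ghostProd]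
  have hpath : ∀ γ : G.FinPath, star (path R γ) = ghostPath R γ := by
    rintro (B | ⟨e, l, _⟩)
    · exact hp B
    · exact hl l e
  rw [hsm, star_mul, star_mul, hp, hpath, ← hpath β, star_star, mul_assoc]

end UltraLPA

end Star

/-- The additive subgroups `𝒜 n` make the star ring `S` a `ℤ`-graded star ring: `S` is their
(internal) direct sum, `𝒜 m * 𝒜 n ⊆ 𝒜 (m + n)` and `(𝒜 n)^* ⊆ 𝒜 (-n)`. -/
structure IsGradedStarRing {S : Type*} [NonUnitalRing S] [StarRing S] (𝒜 : ℤ → AddSubgroup S) :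
    Prop where
  isInternal : DirectSum.IsInternal 𝒜
  mul_mem : ∀ {m n : ℤ} {x y : S}, x ∈ 𝒜 m → y ∈ 𝒜 n → x * y ∈ 𝒜 (m + n)
  star_mem : ∀ {n : ℤ} {x : S}, x ∈ 𝒜 n → star x ∈ 𝒜 (-n)

/-- The component of degree `n` of the product of the algebras `L_{F i}(G)`: the tuples all of whose
entries are homogeneous of degree `n`. -/
def prodHomogeneous {ι : Type*} (F : ι → Type*) [∀ i, Field (F i)] (n : ℤ) :
    AddSubgroup (∀ i, UltraLPA (F i) G) :=
  AddSubgroup.pi Set.univ fun i => (UltraLPA.homogeneous (F i) G n).toAddSubgroup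

end

end Leavitt

/-! The grading comes from the free algebra. Give `s_e`, `s_e^*`, `p_A` the degrees `1`, `-1`, `0`.
Both sides of every defining relation are homogeneous of one common degree
(`LeavittRel.exists_mem_freeHomogeneous`), so the quotient inherits a grading. Directness is
witnessed by `decompose`, which sends a class to the classes of its homogeneous parts and is well
defined because the relations are homogeneous.

The components in the theorem are spans of monomials `s_α p_A s_β^*`, and `mem_homogeneous_iff`
identifies them with the images of the free components. A monomial is the class of an element of
degree `|α| - |β|`. Conversely every word lies in the span of its degree, by induction on its
letters: left multiplication by a generator turns a monomial into another monomial or into `0`.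
Products and stars are then computed on representatives in the free algebra.

For the product, `L_R(G)` is functorial in `R` even for homomorphisms `f` that do not preserve `1`:
a relation is carried to `f 1` times the same relation. The projections `R → F i` and the inclusions
`F i → R` therefore induce maps of Leavitt path algebras. They split `L_R(G)` as the finite product
of the `L_{F i}(G)`, compatibly with degree, scalars and star, and the grading of the product is
transported along this isomorphism. -/

namespace Ultragraph

/-! ### Degrees of symbols and words. -/

/-- The degree of a symbol: `s_e`, `s_e^*` and `p_A` have degree `1`, `-1` and `0`. -/
def Gen.degree {V E : Type*} {G : Ultragraph V E} : G.Gen → ℤ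
  | .edge _ => 1
  | .ghost _ => -1
  | .proj _ => 0

theorem Gen.degree_swap {V E : Type*} {G : Ultragraph V E} (g : G.Gen) :
    g.swap.degree = -g.degree := by
  cases g <;> simp [Gen.swap, Gen.degree]

/-- The degree of a word: the sum of the degrees of its letters. -/
def wordDegree {V E : Type*} (G : Ultragraph V E) (w : FreeSemigroup G.Gen) : ℤ :=
  (FreeSemigroup.lift (fun g : G.Gen => Multiplicative.ofAdd g.degree) w).toAdd

variable {V E : Type*} (G : Ultragraph V E)

theorem wordDegree_of (g : G.Gen) : G.wordDegree (.of g) = g.degree := by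
  simp [wordDegree]

theorem wordDegree_mul (x y : FreeSemigroup G.Gen) :
    G.wordDegree (x * y) = G.wordDegree x + G.wordDegree y := by
  simp [wordDegree]

theorem wordDegree_wordStar (w : FreeSemigroup G.Gen) :
    G.wordDegree (wordStar G w) = -G.wordDegree w := by
  induction w using FreeSemigroup.recOnMul with
  | ih1 g => rw [wordStar_of, wordDegree_of, wordDegree_of, Gen.degree_swap]
  | ih2 g x ih₁ ih₂ =>
    rw [wordStar_mul, wordDegree_mul, wordDegree_mul, ih₁, ih₂, neg_add_rev]

end Ultragraph

open Ultragraph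

noncomputable section

/-! ### The grading of the free algebra and homogeneity of the relations. -/

section Grading

variable (R : Type*) [CommRing R] {V E : Type*} (G : Ultragraph V E)

/-- The homogeneous component of degree `n` of the free algebra. -/
def freeHomogeneous (n : ℤ) : AddSubgroup (FreeUltraAlg R G) :=
  AddSubgroup.closure {x | ∃ w r, G.wordDegree w = n ∧ x = .single w r}

theorem single_mem_freeHomogeneous (w : FreeSemigroup G.Gen) (r : R) :
    MonoidAlgebra.single w r ∈ freeHomogeneous R G (G.wordDegree w) :=
  AddSubgroup.subset_closure ⟨w, r, rfl, rfl⟩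

theorem of_mem_freeHomogeneous (g : G.Gen) :
    FreeUltraAlg.of R g ∈ freeHomogeneous R G g.degree := by
  rw [← wordDegree_of]
  exact single_mem_freeHomogeneous R G _ _

theorem smul_mem_freeHomogeneous (r : R) {n : ℤ} {x : FreeUltraAlg R G}
    (hx : x ∈ freeHomogeneous R G n) : r • x ∈ freeHomogeneous R G n := by
  induction hx using AddSubgroup.closure_induction with
  | mem x hx =>
    obtain ⟨w, s, rfl, rfl⟩ := hx
    rw [MonoidAlgebra.smul_single]
    exact single_mem_freeHomogeneous R G _ _
  | zero => rw [smul_zero]; exact zero_mem _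
  | add x y _ _ hx hy => rw [smul_add]; exact add_mem hx hy
  | neg x _ hx => rw [smul_neg]; exact neg_mem hx

theorem mul_mem_freeHomogeneous {m n : ℤ} {x y : FreeUltraAlg R G}
    (hx : x ∈ freeHomogeneous R G m) (hy : y ∈ freeHomogeneous R G n) :
    x * y ∈ freeHomogeneous R G (m + n) := by
  induction hx using AddSubgroup.closure_induction with
  | mem x hx =>
    obtain ⟨w, r, rfl, rfl⟩ := hx
    induction hy using AddSubgroup.closure_induction with
    | mem y hy =>
      obtain ⟨w', r', rfl, rfl⟩ := hy
      rw [MonoidAlgebra.single_mul_single, ← wordDegree_mul]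
      exact single_mem_freeHomogeneous R G _ _
    | zero => rw [mul_zero]; exact zero_mem _
    | add x y _ _ hx hy => rw [mul_add]; exact add_mem hx hy
    | neg x _ hx => rw [mul_neg]; exact neg_mem hx
  | zero => rw [zero_mul]; exact zero_mem _
  | add x y _ _ hx hy => rw [add_mul]; exact add_mem hx hy
  | neg x _ hx => rw [neg_mul]; exact neg_mem hx

theorem star_mem_freeHomogeneous [StarRing R] {n : ℤ} {x : FreeUltraAlg R G}
    (hx : x ∈ freeHomogeneous R G n) : freeStar R G x ∈ freeHomogeneous R G (-n) := by
  induction hx using AddSubgroup.closure_induction with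
  | mem x hx =>
    obtain ⟨w, s, rfl, rfl⟩ := hx
    rw [freeStar_single, ← wordDegree_wordStar]
    exact single_mem_freeHomogeneous R G _ _
  | zero => rw [map_zero]; exact zero_mem _
  | add x y _ _ hx hy => rw [map_add]; exact add_mem hx hy
  | neg x _ hx => rw [map_neg]; exact neg_mem hx

/-- The defining relations are homogeneous. -/
theorem LeavittRel.exists_mem_freeHomogeneous {x y : FreeUltraAlg R G} (h : LeavittRel R G x y) :
    ∃ n, x ∈ freeHomogeneous R G n ∧ y ∈ freeHomogeneous R G n := by
  have hof := of_mem_freeHomogeneous R G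
  have hp : ∀ A : G.GenVertex, FreeUltraAlg.of R (.proj A) ∈ freeHomogeneous R G 0 :=
    fun A => hof (.proj A)
  have hmul : ∀ (g g' : G.Gen) (n : ℤ), g.degree + g'.degree = n →
      FreeUltraAlg.of R g * FreeUltraAlg.of R g' ∈ freeHomogeneous R G n := by
    rintro g g' n rfl
    exact mul_mem_freeHomogeneous R G (hof g) (hof g')
  induction h with
  | smul r _ ih =>
    obtain ⟨n, hx, hy⟩ := ih
    exact ⟨n, smul_mem_freeHomogeneous R G r hx, smul_mem_freeHomogeneous R G r hy⟩
  | proj_empty => exact ⟨0, hp _, zero_mem _⟩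
  | proj_inter A B => exact ⟨0, hmul (.proj A) (.proj B) 0 rfl, hp _⟩
  | proj_union A B => exact ⟨0, hp _, sub_mem (add_mem (hp A) (hp B)) (hp _)⟩
  | source_edge e => exact ⟨1, hmul (.proj _) (.edge e) 1 rfl, hof (.edge e)⟩
  | edge_range e => exact ⟨1, hmul (.edge e) (.proj _) 1 rfl, hof (.edge e)⟩
  | range_ghost e => exact ⟨-1, hmul (.proj _) (.ghost e) (-1) rfl, hof (.ghost e)⟩
  | ghost_source e => exact ⟨-1, hmul (.ghost e) (.proj _) (-1) rfl, hof (.ghost e)⟩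
  | ghost_edge_self e => exact ⟨0, hmul (.ghost e) (.edge e) 0 rfl, hp _⟩
  | ghost_edge_of_ne e f hef => exact ⟨0, hmul (.ghost e) (.edge f) 0 rfl, zero_mem _⟩
  | regular v hfin hne => exact ⟨0, hp _, sum_mem fun e _ => hmul (.edge e) (.ghost e) 0 rfl⟩

/-! ### Decomposition of classes into homogeneous parts. -/

namespace UltraLPA

variable {R G} in
theorem mk_eq_mk_iff {x y : FreeUltraAlg R G} : mk R G x = mk R G y ↔ leavittCon R G x y :=
  (leavittCon R G).eq

variable {R G} in
theorem mk_eq_of_rel {x y : FreeUltraAlg R G} (h : LeavittRel R G x y) : mk R G x = mk R G y :=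
  mk_eq_mk_iff.2 (.of _ _ h)

/-- The decomposition of an element of the free algebra into the classes of its homogeneous
components. -/
def freeDecompose : FreeUltraAlg R G →+ DirectSum ℤ fun _ => UltraLPA R G :=
  (Finsupp.liftAddHom fun w => (DirectSum.of (fun _ => UltraLPA R G) (G.wordDegree w)).comp
    ((mk R G).toAddMonoidHom.comp (MonoidAlgebra.singleAddHom w))).comp
    MonoidAlgebra.coeffAddEquiv.toAddMonoidHom

theorem freeDecompose_single (w : FreeSemigroup G.Gen) (r : R) :
    freeDecompose R G (.single w r) =
      DirectSum.of (fun _ => UltraLPA R G) (G.wordDegree w) (mk R G (.single w r)) := by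
  simp [freeDecompose]

/-- The target is a Laurent polynomial ring over `L_R(G)`: a full copy of the algebra in each
degree. Multiplicativity is what lets the map pass to the ring congruence generated by the
relations, and not only to the relations themselves. -/
theorem freeDecompose_mul (x y : FreeUltraAlg R G) :
    freeDecompose R G (x * y) = freeDecompose R G x * freeDecompose R G y := by
  induction x using MonoidAlgebra.induction_linear with
  | zero => simp
  | add a b ha hb => rw [add_mul, map_add, ha, hb, map_add, add_mul]
  | single w r =>
    induction y using MonoidAlgebra.induction_linear with
    | zero => simp
    | add a b ha hb => rw [mul_add, map_add, ha, hb, map_add, mul_add]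
    | single w' r' =>
      rw [MonoidAlgebra.single_mul_single, freeDecompose_single, freeDecompose_single,
        freeDecompose_single, DirectSum.of_mul_of, wordDegree_mul,
        ← MonoidAlgebra.single_mul_single, map_mul]
      rfl

theorem freeDecompose_of_mem {n : ℤ} {x : FreeUltraAlg R G} (hx : x ∈ freeHomogeneous R G n) :
    freeDecompose R G x = DirectSum.of (fun _ => UltraLPA R G) n (mk R G x) := by
  induction hx using AddSubgroup.closure_induction with
  | mem x hx =>
    obtain ⟨w, s, rfl, rfl⟩ := hx
    exact freeDecompose_single R G w s
  | zero => simp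
  | add x y _ _ hx hy => simp only [map_add, hx, hy]
  | neg x _ hx => simp only [map_neg, hx]

theorem freeDecompose_eq {x y : FreeUltraAlg R G} (h : leavittCon R G x y) :
    freeDecompose R G x = freeDecompose R G y := by
  change RingConGen.Rel (LeavittRel R G) x y at h
  induction h with
  | of x y h =>
    -- Both sides sit in a single degree `n`, so each is sent to its own class placed in degree `n`,
    -- and these classes agree.
    obtain ⟨n, hx, hy⟩ := h.exists_mem_freeHomogeneous
    rw [freeDecompose_of_mem R G hx, freeDecompose_of_mem R G hy, mk_eq_of_rel h]
  | refl x => rfl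
  | symm _ ih => exact ih.symm
  | trans _ _ ih₁ ih₂ => exact ih₁.trans ih₂
  | add _ _ ih₁ ih₂ => rw [map_add, map_add, ih₁, ih₂]
  | mul _ _ ih₁ ih₂ => rw [freeDecompose_mul, freeDecompose_mul, ih₁, ih₂]

/-- The decomposition of an element of `L_R(G)` into its homogeneous components. -/
def decompose : UltraLPA R G →+ DirectSum ℤ fun _ => UltraLPA R G where
  toFun x := Quotient.liftOn' x (freeDecompose R G) fun _ _ h => freeDecompose_eq R G h
  map_zero' := map_zero (freeDecompose R G)
  map_add' x y := by
    obtain ⟨x, rfl⟩ := mk_surjective R G x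
    obtain ⟨y, rfl⟩ := mk_surjective R G y
    exact map_add (freeDecompose R G) x y

/-! ### Multiplication rules for the generators. -/

section Relations

variable {G}

theorem proj_mul_proj (A B : G.GenVertex) :
    proj R A * proj R B = proj R (A.inter B) := by
  simp only [proj, ← map_mul]
  exact mk_eq_of_rel (.proj_inter A B)

theorem proj_empty : proj R (.empty G) = 0 := by
  rw [← map_zero (mk R G)]
  exact mk_eq_of_rel .proj_empty

theorem proj_mul_self (A : G.GenVertex) : proj R A * proj R A = proj R A := by
  rw [proj_mul_proj]
  congr 1
  exact Subtype.ext (Set.inter_self _)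

theorem proj_source_mul_edge (e : E) :
    proj R (.singleton G (G.source e)) * edge R e = edge R e := by
  simp only [proj, edge, ← map_mul]
  exact mk_eq_of_rel (.source_edge e)

theorem edge_mul_proj_range (e : E) : edge R e * proj R (.range G e) = edge R e := by
  simp only [proj, edge, ← map_mul]
  exact mk_eq_of_rel (.edge_range e)

theorem proj_range_mul_ghost (e : E) :
    proj R (.range G e) * ghost R e = ghost R e := by
  simp only [proj, ghost, ← map_mul]
  exact mk_eq_of_rel (.range_ghost e)

theorem ghost_mul_proj_source (e : E) :
    ghost R e * proj R (.singleton G (G.source e)) = ghost R e := by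
  simp only [proj, ghost, ← map_mul]
  exact mk_eq_of_rel (.ghost_source e)

theorem ghost_mul_edge_self (e : E) :
    ghost R e * edge R e = proj R (.range G e) := by
  simp only [proj, ghost, edge, ← map_mul]
  exact mk_eq_of_rel (.ghost_edge_self e)

theorem ghost_mul_edge_of_ne {e f : E} (h : e ≠ f) :
    ghost R e * edge R f = (0 : UltraLPA R G) := by
  simp only [ghost, edge, ← map_mul]
  rw [← map_zero (mk R G)]
  exact mk_eq_of_rel (.ghost_edge_of_ne e f h)

theorem proj_mul_proj_singleton_of_mem {A : G.GenVertex} {v : V} (h : v ∈ A.1) :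
    proj R A * proj R (.singleton G v) = proj R (.singleton G v) := by
  rw [proj_mul_proj]
  congr 1
  exact Subtype.ext (Set.inter_eq_right.2 (Set.singleton_subset_iff.2 h))

theorem proj_mul_proj_singleton_of_notMem {A : G.GenVertex} {v : V} (h : v ∉ A.1) :
    proj R A * proj R (.singleton G v) = 0 := by
  rw [proj_mul_proj, ← proj_empty R]
  congr 1
  exact Subtype.ext (Set.inter_singleton_eq_empty.2 h)

theorem proj_comm (A B : G.GenVertex) : proj R A * proj R B = proj R B * proj R A := by
  rw [proj_mul_proj, proj_mul_proj]
  congr 1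
  exact Subtype.ext (Set.inter_comm _ _)

theorem proj_mul_edge_of_mem {A : G.GenVertex} {e : E} (h : G.source e ∈ A.1) :
    proj R A * edge R e = edge R e := by
  rw [← proj_source_mul_edge, ← mul_assoc, proj_mul_proj_singleton_of_mem R h]

theorem proj_mul_edge_of_notMem {A : G.GenVertex} {e : E} (h : G.source e ∉ A.1) :
    proj R A * edge R e = 0 := by
  rw [← proj_source_mul_edge, ← mul_assoc, proj_mul_proj_singleton_of_notMem R h, zero_mul]

theorem ghost_mul_proj_of_mem {A : G.GenVertex} {e : E} (h : G.source e ∈ A.1) :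
    ghost R e * proj R A = ghost R e := by
  rw [← ghost_mul_proj_source, mul_assoc, proj_comm, proj_mul_proj_singleton_of_mem R h]

theorem ghost_mul_proj_of_notMem {A : G.GenVertex} {e : E} (h : G.source e ∉ A.1) :
    ghost R e * proj R A = 0 := by
  rw [← ghost_mul_proj_source, mul_assoc, proj_comm, proj_mul_proj_singleton_of_notMem R h,
    mul_zero]

theorem proj_mul_edgeProd_of_mem {A : G.GenVertex} {e : E} (h : G.source e ∈ A.1) (l : List E) :
    proj R A * edgeProd R e l = edgeProd R e l := by
  cases l with
  | nil => exact proj_mul_edge_of_mem R h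
  | cons f l => rw [edgeProd, ← mul_assoc, proj_mul_edge_of_mem R h]

theorem proj_mul_edgeProd_of_notMem {A : G.GenVertex} {e : E} (h : G.source e ∉ A.1)
    (l : List E) : proj R A * edgeProd R e l = 0 := by
  cases l with
  | nil => exact proj_mul_edge_of_notMem R h
  | cons f l => rw [edgeProd, ← mul_assoc, proj_mul_edge_of_notMem R h, zero_mul]

theorem ghost_mul_ghostProd (f : E) (l : List E) (e : E) :
    ghost R f * ghostProd R e l = (ghostProd R e (l ++ [f]) : UltraLPA R G) := by
  induction l generalizing e with
  | nil => rfl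
  | cons g l ih => rw [ghostProd, ← mul_assoc, ih, List.cons_append, ghostProd]

theorem ghost_mul_ghost_of_notMem {e f : E} (h : G.source f ∉ G.range e) :
    ghost R f * ghost R e = (0 : UltraLPA R G) := by
  rw [← proj_range_mul_ghost R e, ← mul_assoc,
    ghost_mul_proj_of_notMem R (A := .range G e) h, zero_mul]

/-- The new ghost edge lands at the end of the path, because `ghostProd` lists edges in reverse. If
`f` does not continue the path, the projections between the last two ghost edges are orthogonal and
the product vanishes. -/
theorem ghost_mul_ghostProd_eq_zero_or (f : E) (l : List E) (e : E)
    (hl : List.IsChain (fun e f => G.source f ∈ G.range e) (e :: l)) :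
    ghost R f * ghostProd R e l = (0 : UltraLPA R G) ∨
      List.IsChain (fun e f => G.source f ∈ G.range e) (e :: (l ++ [f])) := by
  induction l generalizing e with
  | nil =>
    by_cases h : G.source f ∈ G.range e
    · right; simpa using h
    · left; exact ghost_mul_ghost_of_notMem R h
  | cons g l ih =>
    rw [List.isChain_cons_cons] at hl
    refine (ih g hl.2).imp (fun h => ?_) fun h => ?_
    · rw [ghostProd, ← mul_assoc, h, zero_mul]
    · exact List.isChain_cons_cons.2 ⟨hl.1, h⟩

theorem proj_range_mul_ghostProd_concat (f : E) (l : List E) (e : E) :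
    proj R (.range G f) * ghostProd R e (l ++ [f]) = ghostProd R e (l ++ [f]) := by
  rw [← ghost_mul_ghostProd, ← mul_assoc, proj_range_mul_ghost]

end Relations

/-! ### Generators acting on the spanning monomials. -/

variable {R G}

theorem monomial_mem_homogeneous (α β : G.FinPath) (A : G.GenVertex) {n : ℤ}
    (h : (α.length : ℤ) - β.length = n) :
    path R α * proj R A * ghostPath R β ∈ homogeneous R G n :=
  Submodule.subset_span ⟨α, β, A, h, rfl⟩

/-- Left multiplication by a fixed element shifts the components by `k` if it does so on the
spanning monomials. -/
theorem mul_mem_homogeneous_of_monomial {k n : ℤ} {a x : UltraLPA R G}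
    (ha : ∀ (α β : G.FinPath) (A : G.GenVertex),
      a * (path R α * proj R A * ghostPath R β) ∈
        homogeneous R G (k + ((α.length : ℤ) - β.length)))
    (hx : x ∈ homogeneous R G n) : a * x ∈ homogeneous R G (k + n) := by
  induction hx using Submodule.span_induction with
  | mem x hx =>
    obtain ⟨α, β, A, rfl, rfl⟩ := hx
    exact ha α β A
  | zero => rw [mul_zero]; exact zero_mem _
  | add x y _ _ hx hy => rw [mul_add]; exact add_mem hx hy
  | smul r x _ hx => rw [mul_smul_comm]; exact Submodule.smul_mem _ _ hx

theorem proj_mul_mem_homogeneous (B : G.GenVertex) {n : ℤ} {x : UltraLPA R G}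
    (hx : x ∈ homogeneous R G n) : proj R B * x ∈ homogeneous R G (0 + n) := by
  refine mul_mem_homogeneous_of_monomial (fun α β A => ?_) hx
  rw [← mul_assoc, ← mul_assoc, zero_add]
  rcases α with C | ⟨e, l, hl⟩
  · rw [path, proj_mul_proj]
    exact monomial_mem_homogeneous (.vertex _) β A rfl
  · by_cases h : G.source e ∈ B.1
    · rw [path, proj_mul_edgeProd_of_mem R h]
      exact monomial_mem_homogeneous (.edges e l hl) β A rfl
    · rw [path, proj_mul_edgeProd_of_notMem R h, zero_mul, zero_mul]
      exact zero_mem _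

theorem edge_mul_mem_homogeneous (f : E) {n : ℤ} {x : UltraLPA R G}
    (hx : x ∈ homogeneous R G n) : edge R f * x ∈ homogeneous R G (1 + n) := by
  refine mul_mem_homogeneous_of_monomial (fun α β A => ?_) hx
  rw [← mul_assoc, ← mul_assoc]
  rcases α with C | ⟨e, l, hl⟩
  -- The vertex path `C` is merged into the middle projection, leaving room for the one-edge path
  -- `f`.
  · rw [path, mul_assoc (edge R f), proj_mul_proj]
    refine monomial_mem_homogeneous (.edges f [] (List.isChain_singleton f)) β (C.inter A) ?_
    simp only [FinPath.length, List.length_nil]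
    push_cast
    ring
  · by_cases h : G.source e ∈ G.range f
    · refine monomial_mem_homogeneous (.edges f (e :: l) (List.isChain_cons_cons.2 ⟨h, hl⟩)) β A ?_
      simp only [FinPath.length, List.length_cons]
      push_cast
      ring
    -- Writing `s_f = s_f p_{r(f)}` exposes a projection that kills `s_e`, as the source of `e` lies
    -- outside `r(f)`.
    · rw [path, ← edge_mul_proj_range, mul_assoc (edge R f),
        proj_mul_edgeProd_of_notMem R (A := .range G f) h, mul_zero, zero_mul, zero_mul]
      exact zero_mem _

/-- This is the case of `ghost_mul_mem_homogeneous` in which no edge is available to cancel `s_f^*`.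
The ghost edge is absorbed into the path on the right, which grows by one edge. -/
theorem ghost_mul_proj_mul_ghostPath_mem (f : E) (A : G.GenVertex) (β : G.FinPath) {n : ℤ}
    (hn : -1 - (β.length : ℤ) = n) :
    ghost R f * proj R A * ghostPath R β ∈ homogeneous R G n := by
  by_cases hA : G.source f ∈ A.1
  swap
  · rw [ghost_mul_proj_of_notMem R hA, zero_mul]
    exact zero_mem _
  rw [ghost_mul_proj_of_mem R hA]
  rcases β with B | ⟨e, l, hl⟩
  · by_cases hB : G.source f ∈ B.1
    swap
    · rw [ghostPath, ghost_mul_proj_of_notMem R hB]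
      exact zero_mem _
    -- Two copies of `p_{r(f)}` are inserted: one plays the role of `s_α` with `α` of length `0`,
    -- the other that of the middle projection.
    rw [ghostPath, ghost_mul_proj_of_mem R hB, ← proj_range_mul_ghost, ← proj_mul_self]
    refine monomial_mem_homogeneous (.vertex (.range G f))
      (.edges f [] (List.isChain_singleton f)) (.range G f) ?_
    simpa [FinPath.length] using hn
  · rw [ghostPath]
    rcases ghost_mul_ghostProd_eq_zero_or R f l e hl with h | h
    · rw [h]
      exact zero_mem _
    · rw [ghost_mul_ghostProd, ← proj_range_mul_ghostProd_concat, ← proj_mul_self]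
      refine monomial_mem_homogeneous (.vertex (.range G f)) (.edges e (l ++ [f]) h)
        (.range G f) ?_
      rw [← hn]
      simp only [FinPath.length, List.length_append, List.length_singleton]
      push_cast
      ring

theorem ghost_mul_mem_homogeneous (f : E) {n : ℤ} {x : UltraLPA R G}
    (hx : x ∈ homogeneous R G n) : ghost R f * x ∈ homogeneous R G (-1 + n) := by
  refine mul_mem_homogeneous_of_monomial (fun α β A => ?_) hx
  rw [← mul_assoc, ← mul_assoc]
  rcases α with C | ⟨e, l, hl⟩
  · rw [path, mul_assoc (ghost R f), proj_mul_proj]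
    refine ghost_mul_proj_mul_ghostPath_mem f _ β ?_
    simp only [FinPath.length]
    push_cast
    ring
  · rw [path]
    by_cases hfe : f = e
    swap
    · have h0 : ghost R f * edgeProd R e l = (0 : UltraLPA R G) := by
        cases l with
        | nil => exact ghost_mul_edge_of_ne R hfe
        | cons g l => rw [edgeProd, ← mul_assoc, ghost_mul_edge_of_ne R hfe, zero_mul]
      rw [h0, zero_mul, zero_mul]
      exact zero_mem _
    subst hfe
    cases l with
    | nil =>
      rw [edgeProd, ghost_mul_edge_self]
      -- Cancelling the only edge leaves the length-`0` path `r(f)` in place of `α`.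
      refine monomial_mem_homogeneous (.vertex (.range G f)) β A ?_
      simp only [FinPath.length, List.length_nil]
      push_cast
      ring
    | cons g l =>
      rw [List.isChain_cons_cons] at hl
      -- The projection `p_{r(f)}` left by the cancellation is absorbed by the next edge, whose
      -- source lies in `r(f)`.
      rw [edgeProd, ← mul_assoc, ghost_mul_edge_self,
        proj_mul_edgeProd_of_mem R (A := .range G f) hl.1]
      refine monomial_mem_homogeneous (.edges g l hl.2) β A ?_
      simp only [FinPath.length, List.length_cons]
      push_cast
      ring

theorem mk_of_mul_mem_homogeneous (g : G.Gen) {n : ℤ} {x : UltraLPA R G}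
    (hx : x ∈ homogeneous R G n) : mk R G (.of R g) * x ∈ homogeneous R G (g.degree + n) := by
  cases g with
  | edge e => exact edge_mul_mem_homogeneous e hx
  | ghost e => exact ghost_mul_mem_homogeneous e hx
  | proj A => exact proj_mul_mem_homogeneous A hx

/-- Base case of the induction on words. A projection is the monomial `p_A p_A p_A`; edges and ghost
edges reduce to it through `s_e = s_e p_{r(e)}` and `s_e^* = s_e^* p_{s(e)}`. -/
theorem mk_of_mem_homogeneous (g : G.Gen) : mk R G (.of R g) ∈ homogeneous R G g.degree := by
  have hp : ∀ A : G.GenVertex, proj R A ∈ homogeneous R G 0 := fun A => by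
    have h : path R (.vertex A) * proj R A * ghostPath R (.vertex A) ∈ homogeneous R G 0 :=
      monomial_mem_homogeneous (.vertex A) (.vertex A) A (by simp)
    rwa [path, ghostPath, proj_mul_self, proj_mul_self] at h
  cases g with
  | edge e =>
    have h := edge_mul_mem_homogeneous e (hp (.range G e))
    rwa [edge_mul_proj_range] at h
  | ghost e =>
    have h := ghost_mul_mem_homogeneous e (hp (.singleton G (G.source e)))
    rwa [ghost_mul_proj_source] at h
  | proj A => exact hp A

theorem mk_single_mem_homogeneous (w : FreeSemigroup G.Gen) (r : R) :
    mk R G (.single w r) ∈ homogeneous R G (G.wordDegree w) := by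
  -- With coefficient `1` a word splits off its first letter as a factor; the scalar `r` is restored
  -- at the end.
  have h1 : mk R G (.single w 1) ∈ homogeneous R G (G.wordDegree w) := by
    induction w using FreeSemigroup.recOnMul with
    | ih1 g => rw [wordDegree_of]; exact mk_of_mem_homogeneous g
    | ih2 g x _ ih =>
      rw [wordDegree_mul, wordDegree_of, ← mul_one (1 : R), ← MonoidAlgebra.single_mul_single,
        map_mul]
      exact mk_of_mul_mem_homogeneous g ih
  have h2 := Submodule.smul_mem _ r h1
  rwa [smul_mk, MonoidAlgebra.smul_single, smul_eq_mul, mul_one] at h2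

/-! ### Components as images of the free components, and the resulting grading. -/

theorem exists_path_mem (α : G.FinPath) :
    ∃ x ∈ freeHomogeneous R G α.length, mk R G x = path R α := by
  rcases α with A | ⟨e, l, _⟩
  · exact ⟨_, of_mem_freeHomogeneous R G (.proj A), rfl⟩
  · simp only [FinPath.length, path]
    induction l generalizing e with
    | nil => exact ⟨_, of_mem_freeHomogeneous R G (.edge e), rfl⟩
    | cons f l ih =>
      rename_i h
      obtain ⟨x, hx, hx'⟩ := ih f (List.isChain_cons_cons.1 h).2
      refine ⟨.of R (.edge e) * x, ?_, by rw [map_mul, hx', edgeProd, edge]⟩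
      convert mul_mem_freeHomogeneous R G (of_mem_freeHomogeneous R G (.edge e)) hx using 2
      simp only [Gen.degree, List.length_cons]
      push_cast
      ring

theorem exists_ghostPath_mem (α : G.FinPath) :
    ∃ x ∈ freeHomogeneous R G (-α.length), mk R G x = ghostPath R α := by
  rcases α with A | ⟨e, l, _⟩
  · exact ⟨_, of_mem_freeHomogeneous R G (.proj A), rfl⟩
  · simp only [FinPath.length, ghostPath]
    induction l generalizing e with
    | nil => exact ⟨_, of_mem_freeHomogeneous R G (.ghost e), rfl⟩
    | cons f l ih =>
      rename_i h
      obtain ⟨x, hx, hx'⟩ := ih f (List.isChain_cons_cons.1 h).2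
      refine ⟨x * .of R (.ghost e), ?_, by rw [map_mul, hx', ghostProd, ghost]⟩
      convert mul_mem_freeHomogeneous R G hx (of_mem_freeHomogeneous R G (.ghost e)) using 2
      simp only [Gen.degree, List.length_cons]
      push_cast
      ring

/-- The components of `L_R(G)` are the images of the components of the free algebra. -/
theorem mem_homogeneous_iff {n : ℤ} {x : UltraLPA R G} :
    x ∈ homogeneous R G n ↔ ∃ a ∈ freeHomogeneous R G n, mk R G a = x := by
  constructor
  · intro hx
    induction hx using Submodule.span_induction with
    | mem x hx =>
      obtain ⟨α, β, A, rfl, rfl⟩ := hx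
      obtain ⟨a, ha, ha'⟩ := exists_path_mem (R := R) α
      obtain ⟨b, hb, hb'⟩ := exists_ghostPath_mem (R := R) β
      refine ⟨a * .of R (.proj A) * b, ?_, by rw [map_mul, map_mul, ha', hb', proj]⟩
      convert mul_mem_freeHomogeneous R G
        (mul_mem_freeHomogeneous R G ha (of_mem_freeHomogeneous R G (.proj A))) hb using 2
      simp only [Gen.degree]
      ring
    | zero => exact ⟨0, zero_mem _, map_zero _⟩
    | add x y _ _ hx hy =>
      obtain ⟨a, ha, rfl⟩ := hx
      obtain ⟨b, hb, rfl⟩ := hy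
      exact ⟨a + b, add_mem ha hb, map_add _ _ _⟩
    | smul r x _ hx =>
      obtain ⟨a, ha, rfl⟩ := hx
      exact ⟨r • a, smul_mem_freeHomogeneous R G r ha, rfl⟩
  · rintro ⟨a, ha, rfl⟩
    induction ha using AddSubgroup.closure_induction with
    | mem x hx =>
      obtain ⟨w, s, rfl, rfl⟩ := hx
      exact mk_single_mem_homogeneous w s
    | zero => rw [map_zero]; exact zero_mem _
    | add x y _ _ hx hy => rw [map_add]; exact add_mem hx hy
    | neg x _ hx => rw [map_neg]; exact neg_mem hx

theorem decompose_of_mem {n : ℤ} {x : UltraLPA R G} (hx : x ∈ homogeneous R G n) :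
    decompose R G x = DirectSum.of (fun _ => UltraLPA R G) n x := by
  obtain ⟨a, ha, rfl⟩ := mem_homogeneous_iff.1 hx
  exact freeDecompose_of_mem R G ha

variable (R G) in
theorem isInternal_homogeneous :
    DirectSum.IsInternal fun n => (homogeneous R G n).toAddSubgroup := by
  constructor
  -- Followed by `decompose`, the summation map becomes the direct sum of the inclusions of the
  -- components, which is injective.
  · have h : (decompose R G).comp
        (DirectSum.coeAddMonoidHom fun n => (homogeneous R G n).toAddSubgroup) =
        DirectSum.map fun n => (homogeneous R G n).toAddSubgroup.subtype := by
      refine DirectSum.addHom_ext fun n x => ?_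
      rw [AddMonoidHom.comp_apply, DirectSum.coeAddMonoidHom_of, DirectSum.map_of]
      exact decompose_of_mem x.2
    refine Function.Injective.of_comp (f := decompose R G) ?_
    rw [← AddMonoidHom.coe_comp, h, DirectSum.map_injective]
    exact fun n => Subtype.val_injective
  · intro x
    obtain ⟨x, rfl⟩ := mk_surjective R G x
    induction x using MonoidAlgebra.induction_linear with
    | zero => exact ⟨0, by rw [map_zero, map_zero]⟩
    | add a b ha hb =>
      obtain ⟨a', ha⟩ := ha
      obtain ⟨b', hb⟩ := hb
      exact ⟨a' + b', by rw [map_add, map_add, ha, hb]⟩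
    | single w r =>
      exact ⟨DirectSum.of (fun n => (homogeneous R G n).toAddSubgroup) (G.wordDegree w)
        ⟨_, mk_single_mem_homogeneous w r⟩, DirectSum.coeAddMonoidHom_of _ _ _⟩

variable (R G) in
theorem isGradedStarRing_homogeneous [StarRing R] :
    IsGradedStarRing fun n => (homogeneous R G n).toAddSubgroup where
  isInternal := isInternal_homogeneous R G
  mul_mem hx hy := by
    obtain ⟨a, ha, rfl⟩ := mem_homogeneous_iff.1 hx
    obtain ⟨b, hb, rfl⟩ := mem_homogeneous_iff.1 hy
    exact mem_homogeneous_iff.2 ⟨a * b, mul_mem_freeHomogeneous R G ha hb, map_mul _ _ _⟩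
  star_mem hx := by
    obtain ⟨a, ha, rfl⟩ := mem_homogeneous_iff.1 hx
    exact mem_homogeneous_iff.2 ⟨freeStar R G a, star_mem_freeHomogeneous R G ha, rfl⟩

end UltraLPA

end Grading

/-! ### Functoriality in the coefficient ring. -/

section BaseChange

namespace UltraLPA

variable {R S : Type*} [CommRing R] [CommRing S] {V E : Type*} (G : Ultragraph V E)

/-- The map of free algebras induced by a homomorphism of coefficient rings, which need not
preserve the unit. -/
def freeMap (f : R →ₙ+* S) : FreeUltraAlg R G →ₙ+* FreeUltraAlg S G where
  toFun x := MonoidAlgebra.map (f : R →+ S) x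
  map_zero' := by simp
  map_add' x y := MonoidAlgebra.map_add _ x y
  map_mul' x y := by
    induction x using MonoidAlgebra.induction_linear with
    | zero => simp
    | add a b ha hb =>
      rw [add_mul, MonoidAlgebra.map_add, ha, hb, MonoidAlgebra.map_add, add_mul]
    | single w r =>
      induction y using MonoidAlgebra.induction_linear with
      | zero => simp
      | add a b ha hb =>
        rw [mul_add, MonoidAlgebra.map_add, ha, hb, MonoidAlgebra.map_add, mul_add]
      | single w' r' => simp [MonoidAlgebra.single_mul_single]

theorem freeMap_single (f : R →ₙ+* S) (w : FreeSemigroup G.Gen) (r : R) :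
    freeMap G f (.single w r) = .single w (f r) :=
  MonoidAlgebra.map_single _ _ _

theorem freeMap_of (f : R →ₙ+* S) (g : G.Gen) : freeMap G f (.of R g) = f 1 • .of S g := by
  rw [FreeUltraAlg.of, freeMap_single, FreeUltraAlg.of, MonoidAlgebra.smul_single, smul_eq_mul,
    mul_one]

/-- As `f 1` is idempotent, a product of two generators acquires the same scalar as a single
generator. Both sides of each relation are thus scaled equally. -/
theorem freeMap_of_mul_of (f : R →ₙ+* S) (g g' : G.Gen) :
    freeMap G f (.of R g * .of R g') = f 1 • (.of S g * .of S g') := by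
  rw [map_mul, freeMap_of, freeMap_of, smul_mul_smul_comm, ← map_mul, one_mul]

theorem freeMap_smul (f : R →ₙ+* S) (r : R) (x : FreeUltraAlg R G) :
    freeMap G f (r • x) = f r • freeMap G f x := by
  induction x using MonoidAlgebra.induction_linear with
  | zero => simp
  | add a b ha hb => rw [smul_add, map_add, ha, hb, map_add, smul_add]
  | single w r' => simp [MonoidAlgebra.smul_single, freeMap_single]

/-- Each defining relation is mapped to its `f 1`-multiple, which is again a relation because
`LeavittRel` is closed under scalars. -/
theorem leavittRel_freeMap (f : R →ₙ+* S) {x y : FreeUltraAlg R G} (h : LeavittRel R G x y) :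
    LeavittRel S G (freeMap G f x) (freeMap G f y) := by
  induction h with
  | smul r _ ih => rw [freeMap_smul, freeMap_smul]; exact .smul _ ih
  | proj_empty =>
    rw [map_zero, freeMap_of, ← smul_zero (f 1)]
    exact .smul _ .proj_empty
  | proj_inter A B =>
    rw [freeMap_of_mul_of, freeMap_of]
    exact .smul _ (.proj_inter A B)
  | proj_union A B =>
    simp only [map_add, map_sub, freeMap_of, ← smul_add, ← smul_sub]
    exact .smul _ (.proj_union A B)
  | source_edge e =>
    rw [freeMap_of_mul_of, freeMap_of]
    exact .smul _ (.source_edge e)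
  | edge_range e =>
    rw [freeMap_of_mul_of, freeMap_of]
    exact .smul _ (.edge_range e)
  | range_ghost e =>
    rw [freeMap_of_mul_of, freeMap_of]
    exact .smul _ (.range_ghost e)
  | ghost_source e =>
    rw [freeMap_of_mul_of, freeMap_of]
    exact .smul _ (.ghost_source e)
  | ghost_edge_self e =>
    rw [freeMap_of_mul_of, freeMap_of]
    exact .smul _ (.ghost_edge_self e)
  | ghost_edge_of_ne e e' h =>
    rw [freeMap_of_mul_of, map_zero, ← smul_zero (f 1)]
    exact .smul _ (.ghost_edge_of_ne e e' h)
  | regular v hfin hne =>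
    simp only [map_sum, freeMap_of_mul_of, freeMap_of, ← Finset.smul_sum]
    exact .smul _ (.regular v hfin hne)

theorem leavittCon_freeMap (f : R →ₙ+* S) {x y : FreeUltraAlg R G} (h : leavittCon R G x y) :
    leavittCon S G (freeMap G f x) (freeMap G f y) := by
  change RingConGen.Rel (LeavittRel R G) x y at h
  change RingConGen.Rel (LeavittRel S G) _ _
  induction h with
  | of x y h => exact .of _ _ (leavittRel_freeMap G f h)
  | refl x => exact .refl _
  | symm _ ih => exact .symm ih
  | trans _ _ ih₁ ih₂ => exact .trans ih₁ ih₂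
  | add _ _ ih₁ ih₂ => rw [map_add, map_add]; exact .add ih₁ ih₂
  | mul _ _ ih₁ ih₂ => rw [map_mul, map_mul]; exact .mul ih₁ ih₂

/-- The homomorphism `L_R(G) → L_S(G)` induced by a homomorphism `R → S` of coefficient rings,
which need not preserve the unit. -/
def map (f : R →ₙ+* S) : UltraLPA R G →ₙ+* UltraLPA S G where
  toFun := Quotient.map' (freeMap G f) fun _ _ h => leavittCon_freeMap G f h
  map_zero' := congrArg (mk S G) (map_zero (freeMap G f))
  map_add' x y := by
    obtain ⟨x, rfl⟩ := mk_surjective R G x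
    obtain ⟨y, rfl⟩ := mk_surjective R G y
    exact congrArg (mk S G) (map_add (freeMap G f) x y)
  map_mul' x y := by
    obtain ⟨x, rfl⟩ := mk_surjective R G x
    obtain ⟨y, rfl⟩ := mk_surjective R G y
    exact congrArg (mk S G) (map_mul (freeMap G f) x y)

theorem map_mk (f : R →ₙ+* S) (x : FreeUltraAlg R G) :
    map G f (mk R G x) = mk S G (freeMap G f x) := rfl

theorem map_mk_single (f : R →ₙ+* S) (w : FreeSemigroup G.Gen) (r : R) :
    map G f (mk R G (.single w r)) = mk S G (.single w (f r)) := by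
  rw [map_mk, freeMap_single]

theorem map_smul (f : R →ₙ+* S) (r : R) (x : UltraLPA R G) :
    map G f (r • x) = f r • map G f x := by
  obtain ⟨x, rfl⟩ := mk_surjective R G x
  rw [smul_mk, map_mk, freeMap_smul, map_mk, smul_mk]

variable {G} in
/-- Additive maps out of `L_R(G)` that agree on the multiples of words are equal. -/
theorem addHom_ext {M : Type*} [AddZeroClass M] {f g : UltraLPA R G →+ M}
    (h : ∀ w r, f (mk R G (.single w r)) = g (mk R G (.single w r))) : f = g := by
  ext x
  obtain ⟨x, rfl⟩ := mk_surjective R G x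
  induction x using MonoidAlgebra.induction_linear with
  | zero => simp only [map_zero]
  | add a b ha hb => simp only [map_add, ha, hb]
  | single w r => exact h w r

theorem map_star [StarRing R] [StarRing S] (f : R →ₙ+* S) (hf : ∀ r, f (star r) = star (f r))
    (x : UltraLPA R G) : map G f (star x) = star (map G f x) := by
  refine DFunLike.congr_fun (f := (map G f : UltraLPA R G →+ UltraLPA S G).comp
    (starAddEquiv : UltraLPA R G ≃+ UltraLPA R G).toAddMonoidHom)
    (g := (starAddEquiv : UltraLPA S G ≃+ UltraLPA S G).toAddMonoidHom.comp (map G f))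
    (addHom_ext fun w r => ?_) x
  change map G f (star (mk R G _)) = star (map G f (mk R G _))
  rw [star_mk, freeStar_single, map_mk_single, map_mk_single, star_mk, freeStar_single, hf]

theorem map_mem_homogeneous (f : R →ₙ+* S) {n : ℤ} {x : UltraLPA R G}
    (hx : x ∈ homogeneous R G n) : map G f x ∈ homogeneous S G n := by
  obtain ⟨a, ha, rfl⟩ := mem_homogeneous_iff.1 hx
  clear hx
  induction ha using AddSubgroup.closure_induction with
  | mem x hx =>
    obtain ⟨w, s, rfl, rfl⟩ := hx
    rw [map_mk_single]
    exact mk_single_mem_homogeneous w _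
  | zero => simp only [map_zero]; exact zero_mem _
  | add x y _ _ ihx ihy => simp only [map_add]; exact add_mem ihx ihy
  | neg x _ ihx => simp only [map_neg]; exact neg_mem ihx

end UltraLPA

end BaseChange

/-! ### Splitting along a finite product of coefficient rings. -/

section Product

namespace UltraLPA

variable {ι : Type*} {F : ι → Type*} [∀ i, CommRing (F i)]
  {R : Type*} [CommRing R] (e : R ≃+* ∀ i, F i) {V E : Type*} (G : Ultragraph V E)

/-- The projection of `R ≃ ∏ i, F i` to the factor `F i`. -/
def factorProj (i : ι) : R →ₙ+* F i :=
  ((Pi.evalRingHom F i).comp e.toRingHom : R →ₙ+* F i)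

theorem factorProj_apply (i : ι) (r : R) : factorProj e i r = e r i := rfl

variable [DecidableEq ι]

/-- The inclusion of the factor `F i` into `R ≃ ∏ i, F i`. -/
def factorIncl (i : ι) : F i →ₙ+* R :=
  (e.symm.toRingHom : (∀ i, F i) →ₙ+* R).comp
    { toFun := Pi.single i
      map_zero' := Pi.single_zero i
      map_add' := Pi.single_add i
      map_mul' := fun a b => Pi.single_mul i a b }

theorem factorIncl_apply (i : ι) (a : F i) : factorIncl e i a = e.symm (Pi.single i a) := rfl

theorem map_factorProj_factorIncl_self (i : ι) (x : UltraLPA (F i) G) :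
    map G (factorProj e i) (map G (factorIncl e i) x) = x := by
  refine DFunLike.congr_fun (f := (map G (factorProj e i) : UltraLPA R G →+ UltraLPA (F i) G).comp
    (map G (factorIncl e i) : UltraLPA (F i) G →+ UltraLPA R G)) (g := AddMonoidHom.id _)
    (addHom_ext fun w r => ?_) x
  change map G (factorProj e i) (map G (factorIncl e i) (mk _ G (.single w r))) = mk _ G _
  rw [map_mk_single, map_mk_single, factorIncl_apply, factorProj_apply,
    RingEquiv.apply_symm_apply, Pi.single_eq_same]

theorem map_factorProj_factorIncl_of_ne {i j : ι} (h : j ≠ i) (x : UltraLPA (F i) G) :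
    map G (factorProj e j) (map G (factorIncl e i) x) = 0 := by
  refine DFunLike.congr_fun (f := (map G (factorProj e j) : UltraLPA R G →+ UltraLPA (F j) G).comp
    (map G (factorIncl e i) : UltraLPA (F i) G →+ UltraLPA R G)) (g := 0)
    (addHom_ext fun w r => ?_) x
  change map G (factorProj e j) (map G (factorIncl e i) (mk _ G (.single w r))) = 0
  rw [map_mk_single, map_mk_single, factorIncl_apply, factorProj_apply,
    RingEquiv.apply_symm_apply, Pi.single_eq_of_ne h, MonoidAlgebra.single_zero, map_zero]

variable [Fintype ι]

/-- On a word with coefficient `r` this says that `r` is the sum of its coordinates, each included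
back into `R`; finiteness of `ι` makes the sum meaningful. -/
theorem sum_map_factorIncl_factorProj (x : UltraLPA R G) :
    ∑ i, map G (factorIncl e i) (map G (factorProj e i) x) = x := by
  have h : ∑ i, (map G (factorIncl e i) : UltraLPA (F i) G →+ UltraLPA R G).comp
      (map G (factorProj e i) : UltraLPA R G →+ UltraLPA (F i) G) = AddMonoidHom.id _ := by
    refine addHom_ext fun w r => ?_
    rw [AddMonoidHom.finsetSum_apply]
    change ∑ i, map G (factorIncl e i) (map G (factorProj e i) (mk R G (.single w r))) = _
    simp only [map_mk_single, ← map_sum]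
    rw [AddMonoidHom.id_apply]
    congr 1
    have hs : ∑ i, factorIncl e i (factorProj e i r) = r := by
      simp only [factorIncl_apply, factorProj_apply, ← map_sum, Finset.univ_sum_single,
        RingEquiv.symm_apply_apply]
    change ∑ i, MonoidAlgebra.singleAddHom w (factorIncl e i (factorProj e i r)) = _
    rw [← map_sum, hs]
    rfl
  have := DFunLike.congr_fun h x
  rwa [AddMonoidHom.finsetSum_apply] at this

/-- The isomorphism `L_R(G) ≃ ∏ i, L_{F i}(G)` induced by `R ≃ ∏ i, F i`. -/
def piEquiv : UltraLPA R G ≃+* ∀ i, UltraLPA (F i) G where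
  toFun x i := map G (factorProj e i) x
  invFun y := ∑ i, map G (factorIncl e i) (y i)
  left_inv x := sum_map_factorIncl_factorProj e G x
  right_inv y := by
    funext j
    simp only [map_sum]
    rw [Finset.sum_eq_single j, map_factorProj_factorIncl_self]
    · exact fun i _ h => map_factorProj_factorIncl_of_ne e G h.symm _
    · exact fun h => (h (Finset.mem_univ j)).elim
  map_mul' x y := funext fun i => map_mul (map G (factorProj e i)) x y
  map_add' x y := funext fun i => map_add (map G (factorProj e i)) x y

theorem piEquiv_apply_mem_homogeneous_iff {n : ℤ} {x : UltraLPA R G} :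
    (∀ i, piEquiv e G x i ∈ homogeneous (F i) G n) ↔ x ∈ homogeneous R G n := by
  refine ⟨fun h => ?_, fun h i => map_mem_homogeneous G _ h⟩
  -- An element is recovered from its coordinates by maps that preserve degree.
  rw [← sum_map_factorIncl_factorProj e G x]
  exact sum_mem fun i _ => map_mem_homogeneous G _ (h i)

end UltraLPA

/-- Gradings of star rings are transported along isomorphisms. -/
theorem IsGradedStarRing.of_equiv {S T : Type*} [NonUnitalRing S] [StarRing S] [NonUnitalRing T]
    [StarRing T] {𝒜 : ℤ → AddSubgroup S} {ℬ : ℤ → AddSubgroup T} (h : IsGradedStarRing 𝒜)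
    (φ : S ≃⋆+* T) (hφ : ∀ n x, x ∈ 𝒜 n ↔ φ x ∈ ℬ n) : IsGradedStarRing ℬ := by
  have hmem : ∀ {n y}, y ∈ ℬ n → ∃ x ∈ 𝒜 n, φ x = y := fun {n y} hy =>
    ⟨φ.symm y, (hφ _ _).2 (by rwa [φ.apply_symm_apply]), φ.apply_symm_apply y⟩
  refine ⟨?_, fun hx hy => ?_, fun hx => ?_⟩
  · let ψ : ∀ n, 𝒜 n →+ ℬ n := fun n =>
      ((φ : S →+ T).comp (𝒜 n).subtype).codRestrict (ℬ n) fun x => (hφ n x).1 x.2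
    have hψ : ∀ n, Function.Bijective (ψ n) := fun n => by
      refine ⟨fun x y hxy => Subtype.ext (φ.injective (congrArg Subtype.val hxy)), ?_⟩
      rintro ⟨y, hy⟩
      obtain ⟨x, hx, rfl⟩ := hmem hy
      exact ⟨⟨x, hx⟩, rfl⟩
    -- The summation maps of `𝒜` and `ℬ` form a commutative square with `φ` and the bijections `ψ`
    -- between components, so bijectivity passes from one to the other.
    have hcomp : (DirectSum.coeAddMonoidHom ℬ).comp (DirectSum.map ψ) =
        (φ : S →+ T).comp (DirectSum.coeAddMonoidHom 𝒜) := by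
      refine DirectSum.addHom_ext fun n x => ?_
      rw [AddMonoidHom.comp_apply, AddMonoidHom.comp_apply, DirectSum.map_of,
        DirectSum.coeAddMonoidHom_of, DirectSum.coeAddMonoidHom_of]
      rfl
    have hb : Function.Bijective (DirectSum.coeAddMonoidHom ℬ ∘ DirectSum.map ψ) := by
      rw [← AddMonoidHom.coe_comp, hcomp]
      exact φ.bijective.comp h.isInternal
    exact (Function.Bijective.of_comp_iff _ ⟨(DirectSum.map_injective _).2 fun n => (hψ n).1,
      (DirectSum.map_surjective _).2 fun n => (hψ n).2⟩).1 hb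
  · obtain ⟨x, hx', rfl⟩ := hmem hx
    obtain ⟨y, hy', rfl⟩ := hmem hy
    rw [← map_mul]
    exact (hφ _ _).1 (h.mul_mem hx' hy')
  · obtain ⟨x, hx', rfl⟩ := hmem hx
    rw [← map_star]
    exact (hφ _ _).1 (h.star_mem hx')

end Product

end

/-! ### The graded star isomorphism. -/

theorem mainTheorem4 {ι : Type*} [Finite ι] {F : ι → Type*} [∀ i, Field (F i)]
    [∀ i, StarRing (F i)] {R : Type*} [CommRing R] [StarRing R] (e : R ≃⋆+* (∀ i, F i))
    {V E : Type*} (G : Ultragraph V E) :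
    IsGradedStarRing (fun n => (UltraLPA.homogeneous R G n).toAddSubgroup) ∧
    IsGradedStarRing (prodHomogeneous G F) ∧
    ∃ φ : UltraLPA R G ≃⋆+* (∀ i, UltraLPA (F i) G),
      (∀ (r : R) (x : UltraLPA R G) (i : ι), φ (r • x) i = e r i • φ x i) ∧
      ∀ (n : ℤ) (x : UltraLPA R G),
        x ∈ UltraLPA.homogeneous R G n ↔ φ x ∈ prodHomogeneous G F n := by
  classical
  have := Fintype.ofFinite ι
  let φ : UltraLPA R G ≃⋆+* (∀ i, UltraLPA (F i) G) :=
    { UltraLPA.piEquiv e.toRingEquiv G with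
      -- Since `e` preserves the star, which is componentwise on the product, each coordinate
      -- projection of `R` does so too.
      map_star' := fun x => funext fun i => UltraLPA.map_star G _
        (fun r => congrFun (map_star e r) i) x }
  have hφ : ∀ (n : ℤ) (x : UltraLPA R G),
      x ∈ UltraLPA.homogeneous R G n ↔ φ x ∈ prodHomogeneous G F n := fun n x => by
    rw [← UltraLPA.piEquiv_apply_mem_homogeneous_iff e.toRingEquiv G, prodHomogeneous,
      AddSubgroup.mem_pi]
    exact ⟨fun h i _ => h i, fun h i => h i trivial⟩
  have hR := UltraLPA.isGradedStarRing_homogeneous R G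
  exact ⟨hR, hR.of_equiv φ hφ, φ, fun r x i => UltraLPA.map_smul G _ r x, hφ⟩
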